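/- Let $n\in\mathbb{N}$, let $\lambda_n$ denote Lebesgue measure on $\mathbb{R}^n$, let $Y\subset\mathbb{R}^n$ be Lebesgue measurable with $0<\lambda_n(Y)<\infty$, and let $\psi:\mathbb{R}^n\to\mathbb{R}\cup\{-\infty,\infty\}$ be a proper (not identically $\infty$ and nowhere $-\infty$) lower semicontinuous convex function. Let $u^{\#}:Y\to\mathbb{R}^n$ be integrable and be the restriction to $Y$ of the gradient of $\psi$, in the sense that for almost every $y\in Y$ the function $\psi$ is finite near $y$ and differentiable at $y$ with $\nabla\psi(y)=u^{\#}(y)$. The level sets of $u^{\#}$ are the sets $\{y\in Y: u^{\#}(y)=\alpha\}$, $\alpha\in\mathbb{R}^n$; let $Y_0$ be the complement in $Y$ of the union of those level sets of $u^{\#}$ that have positive measure. Suppose that the restriction of $u^{\#}$ to $Y_0$ is not almost injective, that is, there is no set $U_0\subset Y_0$ with $\lambda_n(Y_0\setminus U_0)=0$ on which $u^{\#}$ is injective. Then for every set $\tilde Y\subset Y_0$ with $\lambda_n(Y_0\setminus\tilde Y)=0$ there is $\alpha\in\mathbb{R}^n$ such that the level set $\{y\in Y:u^{\#}(y)=\alpha\}$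 has measure zero and $\{y\in Y:u^{\#}(y)=\alpha\}\cap\tilde Y$ is uncountable. -/

import Mathlib

open MeasureTheory Topology

/-- Convexity of an extended-real-valued function: its epigraph is a convex set. -/
def EConvex {E : Type*} [AddCommGroup E] [Module ℝ E] (ψ : E → EReal) : Prop :=
  Convex ℝ {p : E × ℝ | ψ p.1 ≤ (p.2 : EReal)}

/-- An extended-real-valued function is proper if it is not identically `∞` and nowhere `-∞`. -/
def EProper {E : Type*} (ψ : E → EReal) : Prop :=
  (∃ x, ψ x ≠ ⊤) ∧ ∀ x, ψ x ≠ ⊥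

/-- `ψ` is finite near `x` and differentiable at `x`, with gradient `p`. -/
def EHasGradientAt {E : Type*} [NormedAddCommGroup E] [InnerProductSpace ℝ E] [CompleteSpace E]
    (ψ : E → EReal) (p x : E) : Prop :=
  (∀ᶠ z in 𝓝 x, ψ z ≠ ⊤ ∧ ψ z ≠ ⊥) ∧ HasGradientAt (fun z => (ψ z).toReal) p x

/-- The level set at `a` of the restriction of `f` to `S`. -/
def levelSetOn {E F : Type*} (f : E → F) (S : Set E) (a : F) : Set E :=
  {y | y ∈ S ∧ f y = a}

/-- The complement, in `S`, of the positive-measure level sets of the restriction of `f` to `S`. -/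
def complPosLevelSets {E F : Type*} [MeasureSpace E] (f : E → F) (S : Set E) : Set E :=
  S \ ⋃ a ∈ {a : F | 0 < volume (levelSetOn f S a)}, levelSetOn f S a

/-- The restriction of `f` to `U` is almost injective: it is injective on a subset of `U` of full
measure in `U`. -/
def AlmostInjectiveOn {E F : Type*} [MeasureSpace E] (f : E → F) (U : Set E) : Prop :=
  ∃ U₀ ⊆ U, Set.InjOn f U₀ ∧ volume (U \ U₀) = 0

/-! If the conclusion fails, the gradient has countable fibres on a subset of full measure in `Y₀`;
it suffices that a gradient of a convex function with countable fibres is almost injective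
(`ConvexOn.measure_nonunique_gradient_eq_zero`).

Two points with one gradient span a segment in a face, and this segment crosses one of countably
many hyperplane pieces `K`. So it is enough to treat a compact set `A` strictly on one side of such
a `K`, every point of which has a face meeting `K`. Slide `A` towards `K` along the faces by the
ratio `t`. The slid set has measure at least `(1 - t) ^ n * μ A` (`ConvexOn.le_measure_slideSet`):
for finitely many targets this is a disjoint union of homotheties, and compactness gives the general
case. But faces of different slopes do not meet inside such segments, so a given point is reached
for only countably many `t` (`ConvexOn.countable_slide_parameters`). By Fubini almost every slid set
is null, hence so is `A`. -/

/-- The points of `S` at which `f` does not exceed the affine function of slope `p` that agrees with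
`f` at `y`. If `p` is a subgradient of `f` at `y`, this is the face of `f` of slope `p`. -/
def contactSet {E : Type*} [NormedAddCommGroup E] [InnerProductSpace ℝ E]
    (S : Set E) (f : E → ℝ) (p y : E) : Set E :=
  {x | x ∈ S ∧ f x ≤ f y + inner ℝ p (x - y)}

/-! ### Subgradients and faces of a convex function -/

section Convex

variable {E : Type*} [NormedAddCommGroup E] [InnerProductSpace ℝ E] [CompleteSpace E]
  {S : Set E} {f : E → ℝ}

theorem ConvexOn.add_inner_le_of_hasGradientAt (hf : ConvexOn ℝ S f) {p y z : E} (hy : y ∈ S)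
    (hp : HasGradientAt f p y) (hz : z ∈ S) : f y + inner ℝ p (z - y) ≤ f z := by
  have hline : HasDerivAt (fun s : ℝ => y + s • (z - y)) (z - y) 0 := by
    simpa using ((hasDerivAt_id (0 : ℝ)).smul_const (z - y)).const_add y
  have hg : HasDerivAt (fun s : ℝ => f (y + s • (z - y))) (inner ℝ p (z - y)) 0 := by
    have h0 : HasFDerivAt f (InnerProductSpace.toDual ℝ E p) (y + (0 : ℝ) • (z - y)) := by
      simpa using hp.hasFDerivAt
    simpa [Function.comp_def] using h0.comp_hasDerivAt (0 : ℝ) hline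
  have hlim := hg.tendsto_slope_zero_right
  have hle : ∀ᶠ s in 𝓝[>] (0 : ℝ),
      s⁻¹ • (f (y + (0 + s) • (z - y)) - f (y + (0 : ℝ) • (z - y))) ≤ f z - f y := by
    have h1 : ∀ᶠ s in 𝓝[>] (0 : ℝ), s < 1 :=
      (eventually_lt_nhds one_pos).filter_mono nhdsWithin_le_nhds
    filter_upwards [h1, self_mem_nhdsWithin] with s hs1 hs0
    have hs0 : 0 < s := hs0
    have hc := hf.2 hy hz (sub_nonneg.2 hs1.le) hs0.le (by ring)
    have he : (1 - s) • y + s • z = y + s • (z - y) := by module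
    rw [he] at hc
    simp only [zero_add, zero_smul, add_zero, smul_eq_mul] at hc ⊢
    rw [inv_mul_le_iff₀ hs0]
    linarith
  have := le_of_tendsto hlim hle
  linarith

theorem HasGradientAt.eq_of_add_inner_le {p q y : E} (hp : HasGradientAt f p y) (hS : S ∈ 𝓝 y)
    (hq : ∀ z ∈ S, f y + inner ℝ q (z - y) ≤ f z) : q = p := by
  have hmin : IsLocalMin (fun z => f z - inner ℝ q z) y := by
    filter_upwards [hS] with z hz
    have := hq z hz
    rw [inner_sub_right] at this
    linarith
  have hd : HasFDerivAt (fun z => f z - inner ℝ q z)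
      (InnerProductSpace.toDual ℝ E p - InnerProductSpace.toDual ℝ E q) y :=
    hp.hasFDerivAt.sub (InnerProductSpace.toDual ℝ E q).hasFDerivAt
  have := hmin.hasFDerivAt_eq_zero hd
  rw [← map_sub] at this
  have h2 : p - q = 0 :=
    (map_eq_zero_iff _ (InnerProductSpace.toDual ℝ E).injective).1 this
  exact (sub_eq_zero.1 h2).symm

/-- A subgradient at a point of the contact set that also contains `y` is the gradient at `y`. -/
theorem ConvexOn.gradient_eq_of_le (hf : ConvexOn ℝ S f) {p q y y' : E} (hS : S ∈ 𝓝 y)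
    (hp : HasGradientAt f p y) (hy' : y' ∈ S) (hq : HasGradientAt f q y')
    (h : f y ≤ f y' + inner ℝ q (y - y')) : p = q := by
  symm
  refine hp.eq_of_add_inner_le hS fun z hz => ?_
  have := hf.add_inner_le_of_hasGradientAt hy' hq hz
  have e : (inner ℝ q (z - y') : ℝ) = inner ℝ q (z - y) + inner ℝ q (y - y') := by
    rw [← inner_add_right]; congr 1; abel
  linarith

/-- Segments starting at points of differentiability, and running in faces, have the same slope as
soon as they meet away from their end points. -/
theorem ConvexOn.gradient_eq_of_segments_meet (hf : ConvexOn ℝ S f) {p p' y y' x x' : E} {s t : ℝ}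
    (hS : S ∈ 𝓝 y) (hp : HasGradientAt f p y) (hS' : S ∈ 𝓝 y') (hp' : HasGradientAt f p' y')
    (hx : x ∈ contactSet S f p y) (hx' : x' ∈ contactSet S f p' y')
    (ht0 : 0 ≤ t) (ht1 : t < 1) (hs0 : 0 ≤ s) (hs1 : s ≤ 1)
    (h : (1 - t) • y + t • x = (1 - s) • y' + s • x') : p = p' := by
  have hyS := mem_of_mem_nhds hS
  have hyS' := mem_of_mem_nhds hS'
  refine hf.gradient_eq_of_le hS hp hyS' hp' ?_
  set z := (1 - t) • y + t • x with hz
  have hzS : z ∈ S := hf.1 hyS hx.1 (by linarith) ht0 (by ring)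
  have hz1 : f y + inner ℝ p (z - y) ≤ f z := hf.add_inner_le_of_hasGradientAt hyS hp hzS
  have hz2 : f z ≤ (1 - s) * f y' + s * f x' := by
    rw [h]; exact hf.2 hyS' hx'.1 (by linarith) hs0 (by ring)
  have hx1 := hx.2
  have hx2 := hx'.2
  have hx3 := hf.add_inner_le_of_hasGradientAt hyS' hp' hx.1
  have e1 : (inner ℝ p (z - y) : ℝ) = t * inner ℝ p (x - y) := by
    rw [← real_inner_smul_right, hz]; congr 1; module
  have e2 : (s * inner ℝ p' (x' - y') : ℝ)
      = (1 - t) * inner ℝ p' (y - y') + t * inner ℝ p' (x - y') := by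
    rw [← real_inner_smul_right, ← real_inner_smul_right, ← real_inner_smul_right,
      ← inner_add_right]
    congr 1
    have : s • (x' - y') = z - y' := by rw [h]; module
    rw [this, hz]; module
  -- Along the segment from `y` to `x`, `f` is affine, lies above the support of slope `p'` at `x`
  -- and meets it at `z`; hence it is not above it at `y`. The weight `1 - t` is positive, so it can
  -- be cancelled.
  have h3 : (1 - t) * f y ≤ (1 - t) * (f y' + inner ℝ p' (y - y')) := by
    nlinarith [mul_le_mul_of_nonneg_left hx2 hs0, mul_le_mul_of_nonneg_left hx1 ht0,
      mul_le_mul_of_nonneg_left hx3 ht0]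
  exact le_of_mul_le_mul_left h3 (by linarith)

/-- If `σ` is monotone in the sense that `σ q` minimises `f - ⟪q, ·⟫` over a set containing the
values of `σ`, sliding each point of differentiability towards `σ` of its gradient separates
points with different gradients. -/
theorem ConvexOn.gradient_eq_of_slide_eq (hf : ConvexOn ℝ S f) {σ : E → E}
    (hσ : ∀ p q, f (σ p) - inner ℝ p (σ p) ≤ f (σ q) - inner ℝ p (σ q)) {p p' y y' : E} {t : ℝ}
    (hS : S ∈ 𝓝 y) (hp : HasGradientAt f p y) (hS' : S ∈ 𝓝 y') (hp' : HasGradientAt f p' y')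
    (ht0 : 0 ≤ t) (ht1 : t < 1)
    (h : (1 - t) • y + t • σ p = (1 - t) • y' + t • σ p') : p = p' := by
  have hyS := mem_of_mem_nhds hS
  have hyS' := mem_of_mem_nhds hS'
  refine hf.gradient_eq_of_le hS hp hyS' hp' ?_
  have h1 := hf.add_inner_le_of_hasGradientAt hyS hp hyS'
  have h2 := hf.add_inner_le_of_hasGradientAt hyS' hp' hyS
  have h3 := hσ p p'
  have h4 := hσ p' p
  have h5 : (1 - t) • (y - y') + t • (σ p - σ p') = 0 := by
    have : (1 - t) • (y - y') + t • (σ p - σ p')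
      = ((1 - t) • y + t • σ p) - ((1 - t) • y' + t • σ p') := by module
    rw [this, h, sub_self]
  -- Pairing with `p - p'` makes both terms nonnegative, since the gradient and `σ` are both
  -- monotone; so both vanish.
  have h6 : (1 - t) * inner ℝ (p - p') (y - y') + t * inner ℝ (p - p') (σ p - σ p') = 0 := by
    rw [← real_inner_smul_right, ← real_inner_smul_right, ← inner_add_right, h5, inner_zero_right]
  simp only [inner_sub_left, inner_sub_right] at h1 h2 h6 ⊢
  have h7 : 0 ≤ t * (inner ℝ p (σ p) - inner ℝ p' (σ p) - (inner ℝ p (σ p') - inner ℝ p' (σ p'))) :=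
    mul_nonneg ht0 (by linarith)
  have h8 : (1 - t) * (inner ℝ p y - inner ℝ p' y - (inner ℝ p y' - inner ℝ p' y')) ≤ 0 := by
    linarith
  have h9 : inner ℝ p y - inner ℝ p' y - (inner ℝ p y' - inner ℝ p' y') ≤ 0 := by
    by_contra hc
    exact absurd h8 (not_le.2 (mul_pos (by linarith) (not_le.1 hc)))
  linarith

end Convex

/-! ### Measurable selection and Lusin's theorem -/

/-- A measurable choice of a minimiser of `f - ⟪p, ·⟫` over a finite set. -/
theorem exists_measurable_argmin {E : Type*} [NormedAddCommGroup E] [InnerProductSpace ℝ E]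
    [MeasurableSpace E] [BorelSpace E] (f : E → ℝ) (X : Finset E)
    (hX : X.Nonempty) : ∃ σ : E → E, Measurable σ ∧ (∀ p, σ p ∈ X) ∧
      ∀ p, ∀ x ∈ X, f (σ p) - inner ℝ p (σ p) ≤ f x - inner ℝ p x := by
  -- The minimal value `v` is carried along because its measurability decides where a newly added
  -- point wins.
  suffices H : ∃ (σ : E → E) (v : E → ℝ), Measurable σ ∧ Measurable v ∧
      (∀ p, v p = f (σ p) - inner ℝ p (σ p)) ∧ (∀ p, σ p ∈ X) ∧
      ∀ p, ∀ x ∈ X, v p ≤ f x - inner ℝ p x by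
    obtain ⟨σ, v, h1, -, h2, h3, h4⟩ := H
    exact ⟨σ, h1, h3, fun p x hx => h2 p ▸ h4 p x hx⟩
  have hm : ∀ a : E, Measurable fun p : E => f a - inner ℝ p a := fun a =>
    (continuous_const.sub (continuous_id.inner continuous_const)).measurable
  induction hX using Finset.Nonempty.cons_induction with
  | singleton a =>
    exact ⟨fun _ => a, fun p => f a - inner ℝ p a, measurable_const, hm a, by simp, by simp,
      by simp⟩
  | cons a s ha hs ih =>
    obtain ⟨σ, v, h1, h2, h3, h4, h5⟩ := ih
    have hset : MeasurableSet {p : E | f a - inner ℝ p a ≤ v p} := measurableSet_le (hm a) h2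
    classical
    refine ⟨fun p => if f a - inner ℝ p a ≤ v p then a else σ p,
      fun p => if f a - inner ℝ p a ≤ v p then f a - inner ℝ p a else v p,
      Measurable.ite hset measurable_const h1, Measurable.ite hset (hm a) h2, ?_, ?_, ?_⟩
    · intro p
      by_cases h : f a - inner ℝ p a ≤ v p
      · simp only [if_pos h]
      · simp only [if_neg h]; exact h3 p
    · intro p
      by_cases h : f a - inner ℝ p a ≤ v p
      · simp only [if_pos h]; simp
      · simp only [if_neg h]; simp [h4 p]
    · intro p x hx
      rw [Finset.mem_cons] at hx
      by_cases h : f a - inner ℝ p a ≤ v p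
      · simp only [if_pos h]
        rcases hx with rfl | hx
        · exact le_rfl
        · exact h.trans (h5 p x hx)
      · simp only [if_neg h]
        rcases hx with rfl | hx
        · exact (not_le.1 h).le
        · exact h5 p x hx

/-- **Lusin's theorem**: a measurable function is continuous on a compact subset of almost full
measure. -/
theorem exists_isCompact_continuousOn {E F : Type*} [TopologicalSpace E] [T2Space E]
    [MeasurableSpace E] [BorelSpace E] [TopologicalSpace F] [SecondCountableTopology F]
    [MeasurableSpace F] [OpensMeasurableSpace F] {μ : Measure E} [μ.InnerRegularCompactLTTop]
    {u : E → F} (hu : Measurable u) {A : Set E} (hA : MeasurableSet A) (hfin : μ A ≠ ⊤)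
    {ε : ENNReal} (hε : ε ≠ 0) : ∃ K ⊆ A, IsCompact K ∧ ContinuousOn u K ∧ μ (A \ K) < ε := by
  let B := TopologicalSpace.countableBasis F
  have hB := TopologicalSpace.isBasis_countableBasis F
  have : Countable B := (TopologicalSpace.countable_countableBasis F).to_subtype
  obtain ⟨δ, hδ, hsum⟩ := ENNReal.exists_pos_sum_of_countable' (ENNReal.half_pos hε).ne' B
  have hδ2 : ∀ V : B, δ V / 2 ≠ 0 := fun V => (ENNReal.half_pos (hδ V).ne').ne'
  have hm : ∀ V : B, MeasurableSet (u ⁻¹' V.1) := fun V =>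
    hu (hB.isOpen V.2).measurableSet
  have hC : ∀ V : B, ∃ C ⊆ A ∩ u ⁻¹' V.1, IsCompact C ∧ μ ((A ∩ u ⁻¹' V.1) \ C) < δ V / 2 :=
    fun V => (hA.inter (hm V)).exists_isCompact_sdiff_lt
      (measure_ne_top_of_subset Set.inter_subset_left hfin) (hδ2 V)
  have hD : ∀ V : B, ∃ C ⊆ A \ u ⁻¹' V.1, IsCompact C ∧ μ ((A \ u ⁻¹' V.1) \ C) < δ V / 2 :=
    fun V => (hA.diff (hm V)).exists_isCompact_sdiff_lt
      (measure_ne_top_of_subset Set.sdiff_subset hfin) (hδ2 V)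
  choose C hCs hCc hCm using hC
  choose D hDs hDc hDm using hD
  obtain ⟨K₀, hK₀s, hK₀c, hK₀m⟩ := hA.exists_isCompact_sdiff_lt hfin (ENNReal.half_pos hε).ne'
  -- On this set every basic preimage is relatively open, its complement being cut out by the closed
  -- set `D V`.
  refine ⟨K₀ ∩ ⋂ V, (C V ∪ D V), Set.inter_subset_left.trans hK₀s,
    hK₀c.inter_right (isClosed_iInter fun V => ((hCc V).union (hDc V)).isClosed), ?_, ?_⟩
  · intro x hx
    rw [ContinuousWithinAt, hB.nhds_hasBasis.tendsto_right_iff]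
    rintro V ⟨hV, hxV⟩
    have hxD : x ∉ D ⟨V, hV⟩ := fun h => (hDs _ h).2 hxV
    have hn : (D ⟨V, hV⟩)ᶜ ∈ 𝓝 x := (hDc _).isClosed.isOpen_compl.mem_nhds hxD
    filter_upwards [mem_nhdsWithin_of_mem_nhds hn, self_mem_nhdsWithin] with y hy hyK
    rcases Set.mem_iInter.1 hyK.2 ⟨V, hV⟩ with h | h
    · exact (hCs _ h).2
    · exact absurd h hy
  · have hsub : A \ (K₀ ∩ ⋂ V, (C V ∪ D V)) ⊆
        (A \ K₀) ∪ ⋃ V, (((A ∩ u ⁻¹' V.1) \ C V) ∪ ((A \ u ⁻¹' V.1) \ D V)) := by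
      rintro x ⟨hxA, hx⟩
      by_cases hxK : x ∈ K₀
      · right
        have : x ∉ ⋂ V, (C V ∪ D V) := fun h => hx ⟨hxK, h⟩
        rw [Set.mem_iInter] at this
        push Not at this
        obtain ⟨V, hV⟩ := this
        rw [Set.mem_union] at hV
        push Not at hV
        refine Set.mem_iUnion.2 ⟨V, ?_⟩
        by_cases hxV : x ∈ u ⁻¹' V.1
        · exact Or.inl ⟨⟨hxA, hxV⟩, hV.1⟩
        · exact Or.inr ⟨⟨hxA, hxV⟩, hV.2⟩
      · exact Or.inl ⟨hxA, hxK⟩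
    calc μ (A \ (K₀ ∩ ⋂ V, (C V ∪ D V))) ≤ _ := measure_mono hsub
      _ ≤ _ := measure_union_le _ _
      _ ≤ μ (A \ K₀) + ∑' V, δ V := by
        gcongr
        refine (measure_iUnion_le _).trans (ENNReal.tsum_le_tsum fun V => ?_)
        refine (measure_union_le _ _).trans ?_
        calc _ ≤ δ V / 2 + δ V / 2 := add_le_add (hCm V).le (hDm V).le
          _ = δ V := ENNReal.add_halves _
      _ < ε / 2 + ε / 2 := ENNReal.add_lt_add hK₀m hsum
      _ = ε := ENNReal.add_halves _

/-! ### Sliding along faces and the lower volume bound -/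

section Slide

variable {E : Type*} [NormedAddCommGroup E] [InnerProductSpace ℝ E]
  {S : Set E} {f : E → ℝ} {u : E → E} {A K : Set E}

/-- The set of pairs formed by a point of `A` and a point of `K` in its contact set. -/
def contactPairs (S : Set E) (f : E → ℝ) (u : E → E) (A K : Set E) : Set (E × E) :=
  {q | q.1 ∈ A ∧ q.2 ∈ K ∧ q.2 ∈ contactSet S f (u q.1) q.1}

/-- The points that divide, in the ratio `t`, the segments from points of `A` to the points of `K`
in their contact sets. -/
def slideSet (S : Set E) (f : E → ℝ) (u : E → E) (A K : Set E) (t : ℝ) : Set E :=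
  (fun q : E × E => (1 - t) • q.1 + t • q.2) '' contactPairs S f u A K

/-- The tolerance is kept as a bounded coordinate, so that one compact set serves both exact contact
(tolerance `0`) and the passage to small tolerances. -/
theorem isCompact_approx_contactPairs
    (hepi : IsClosed {p : E × ℝ | p.1 ∈ S ∧ f p.1 ≤ p.2}) (hA : IsCompact A) (hK : IsCompact K)
    (hu : ContinuousOn u A) (hfA : ContinuousOn f A) :
    IsCompact {q : (E × E) × ℝ | (q.1.1 ∈ A ∧ q.1.2 ∈ K ∧ q.2 ∈ Set.Icc (0 : ℝ) 1) ∧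
      q.1.2 ∈ S ∧ f q.1.2 ≤ f q.1.1 + inner ℝ (u q.1.1) (q.1.2 - q.1.1) + q.2} := by
  have hc : IsCompact ((A ×ˢ K) ×ˢ Set.Icc (0 : ℝ) 1) := (hA.prod hK).prod isCompact_Icc
  have h1 : ContinuousOn (fun q : (E × E) × ℝ => q.1.1) ((A ×ˢ K) ×ˢ Set.Icc (0 : ℝ) 1) := by
    fun_prop
  have hmaps : Set.MapsTo (fun q : (E × E) × ℝ => q.1.1) ((A ×ˢ K) ×ˢ Set.Icc (0 : ℝ) 1) A :=
    fun q hq => hq.1.1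
  have h2 := hu.comp h1 hmaps
  have h3 := hfA.comp h1 hmaps
  have hcont : ContinuousOn (fun q : (E × E) × ℝ =>
      (q.1.2, f q.1.1 + inner ℝ (u q.1.1) (q.1.2 - q.1.1) + q.2))
      ((A ×ˢ K) ×ˢ Set.Icc (0 : ℝ) 1) := by
    refine ContinuousOn.prodMk (by fun_prop) (ContinuousOn.add (ContinuousOn.add h3 ?_) (by fun_prop))
    exact h2.inner (by fun_prop)
  have hcl := hcont.preimage_isClosed_of_isClosed hc.isClosed hepi
  convert hc.of_isClosed_subset hcl Set.inter_subset_left using 1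
  ext q
  simp only [Set.mem_ofPred_eq, Set.mem_inter_iff, Set.mem_prod, Set.mem_preimage, and_assoc]

theorem isCompact_contactPairs
    (hepi : IsClosed {p : E × ℝ | p.1 ∈ S ∧ f p.1 ≤ p.2}) (hA : IsCompact A) (hK : IsCompact K)
    (hu : ContinuousOn u A) (hfA : ContinuousOn f A) : IsCompact (contactPairs S f u A K) := by
  have h := ((isCompact_approx_contactPairs hepi hA hK hu hfA).inter_right
    (isClosed_singleton.preimage continuous_snd : IsClosed (Prod.snd ⁻¹' {(0 : ℝ)}))).image
      continuous_fst
  convert h using 1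
  ext q
  constructor
  · rintro ⟨h1, h2, h3, h4⟩
    exact ⟨(q, 0), ⟨⟨⟨h1, h2, by simp⟩, h3, by simpa using h4⟩, rfl⟩, rfl⟩
  · rintro ⟨⟨q', r⟩, ⟨⟨⟨h1, h2, -⟩, h3, h4⟩, h5⟩, rfl⟩
    have h5 : r = 0 := h5
    subst h5
    exact ⟨h1, h2, h3, by simpa using h4⟩

/-- Pairs that are nearly in contact are sent near the slide set. -/
theorem exists_approx_contact_slide_subset
    (hepi : IsClosed {p : E × ℝ | p.1 ∈ S ∧ f p.1 ≤ p.2}) (hA : IsCompact A) (hK : IsCompact K)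
    (hu : ContinuousOn u A) (hfA : ContinuousOn f A) {t : ℝ} {U : Set E} (hU : IsOpen U)
    (hsub : slideSet S f u A K t ⊆ U) :
    ∃ δ > 0, ∀ y ∈ A, ∀ x ∈ K, x ∈ S → f x ≤ f y + inner ℝ (u y) (x - y) + δ →
      (1 - t) • y + t • x ∈ U := by
  have hcont : Continuous fun q : (E × E) × ℝ => (1 - t) • q.1.1 + t • q.1.2 := by fun_prop
  -- The tolerances of pairs sent outside `U` form a compact set missing `0`, hence they stay away
  -- from `0`.
  have hcomp := ((isCompact_approx_contactPairs hepi hA hK hu hfA).inter_right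
    (hU.isClosed_compl.preimage hcont)).image continuous_snd
  have h0 : (0 : ℝ) ∉ Prod.snd '' ({q : (E × E) × ℝ | (q.1.1 ∈ A ∧ q.1.2 ∈ K ∧
      q.2 ∈ Set.Icc (0 : ℝ) 1) ∧ q.1.2 ∈ S ∧
      f q.1.2 ≤ f q.1.1 + inner ℝ (u q.1.1) (q.1.2 - q.1.1) + q.2} ∩
      (fun q : (E × E) × ℝ => (1 - t) • q.1.1 + t • q.1.2) ⁻¹' Uᶜ) := by
    rintro ⟨⟨q, r⟩, ⟨⟨⟨h1, h2, -⟩, h3, h4⟩, h5⟩, h6⟩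
    have h6 : r = 0 := h6
    subst h6
    exact h5 (hsub ⟨q, ⟨h1, h2, h3, by simpa using h4⟩, rfl⟩)
  obtain ⟨ε, hε, hball⟩ := Metric.isOpen_iff.1 hcomp.isClosed.isOpen_compl 0 h0
  have hδ : 0 < min (ε / 2) 1 := by positivity
  refine ⟨min (ε / 2) 1, hδ, fun y hy x hx hxS hle => ?_⟩
  by_contra hn
  refine hball (a := min (ε / 2) 1) ?_ ⟨((y, x), min (ε / 2) 1),
    ⟨⟨⟨hy, hx, hδ.le, min_le_right _ _⟩, hxS, hle⟩, hn⟩, rfl⟩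
  rw [Metric.mem_ball, Real.dist_0_eq_abs, abs_of_pos hδ]
  exact (min_le_left _ _).trans_lt (by linarith)

/-- Finitely many points of `K` are nearly in contact with all points of `A`. -/
theorem exists_finset_approx_contact (hA : IsCompact A)
    (hu : ContinuousOn u A) (hfA : ContinuousOn f A)
    (hcontact : ∀ y ∈ A, ∃ x ∈ K, x ∈ contactSet S f (u y) y) {δ : ℝ} (hδ : 0 < δ) :
    ∃ X : Finset E, (∀ x ∈ X, x ∈ K ∧ x ∈ S) ∧
      ∀ y ∈ A, ∃ x ∈ X, f x ≤ f y + inner ℝ (u y) (x - y) + δ := by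
  classical
  refine hA.induction_on (p := fun s => ∃ X : Finset E, (∀ x ∈ X, x ∈ K ∧ x ∈ S) ∧
      ∀ y ∈ s, ∃ x ∈ X, f x ≤ f y + inner ℝ (u y) (x - y) + δ) ?_ ?_ ?_ ?_
  · exact ⟨∅, by simp, by simp⟩
  · rintro s s' hss ⟨X, h1, h2⟩
    exact ⟨X, h1, fun y hy => h2 y (hss hy)⟩
  · rintro s s' ⟨X, h1, h2⟩ ⟨X', h1', h2'⟩
    refine ⟨X ∪ X', fun x hx => ?_, fun y hy => ?_⟩
    · rcases Finset.mem_union.1 hx with h | h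
      exacts [h1 x h, h1' x h]
    · rcases hy with h | h
      · obtain ⟨x, hx, hle⟩ := h2 y h
        exact ⟨x, Finset.mem_union_left _ hx, hle⟩
      · obtain ⟨x, hx, hle⟩ := h2' y h
        exact ⟨x, Finset.mem_union_right _ hx, hle⟩
  · intro y hy
    obtain ⟨x, hxK, hxS, hle⟩ := hcontact y hy
    have hc : ContinuousWithinAt (fun y' => f y' + inner ℝ (u y') (x - y') + δ) A y :=
      ((hfA.add (hu.inner (by fun_prop))).add continuousOn_const) y hy
    refine ⟨_, hc.eventually_const_lt (u := f x) (by linarith), {x}, by simp [hxK, hxS], ?_⟩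
    intro y' hy'
    exact ⟨x, by simp, le_of_lt hy'⟩

variable [FiniteDimensional ℝ E] [MeasurableSpace E] [BorelSpace E]

/-- Sliding points of differentiability towards finitely many points contracts volume by exactly
the factor of a homothety. -/
theorem ConvexOn.measure_slide_image (μ : Measure E) [μ.IsAddHaarMeasure] (hf : ConvexOn ℝ S f)
    (hA : IsCompact A) (hu : Measurable u)
    (hgrad : ∀ y ∈ A, S ∈ 𝓝 y ∧ HasGradientAt f (u y) y) (X : Finset E) {σ : E → E}
    (hσm : Measurable σ) (hσX : ∀ p, σ p ∈ X)
    (hσ : ∀ p, ∀ x ∈ X, f (σ p) - inner ℝ p (σ p) ≤ f x - inner ℝ p x)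
    {t : ℝ} (ht0 : 0 ≤ t) (ht1 : t < 1) :
    ENNReal.ofReal ((1 - t) ^ Module.finrank ℝ E) * μ A ≤
      μ ((fun y => (1 - t) • y + t • σ (u y)) '' A) := by
  have hmeas : ∀ x, MeasurableSet (A ∩ (σ ∘ u) ⁻¹' {x}) := fun x =>
    hA.measurableSet.inter ((hσm.comp hu) (measurableSet_singleton x))
  have hhom : ∀ x : E, ∀ s : Set E, (fun y => (1 - t) • y + t • x) '' s
      = AffineMap.homothety x (1 - t) '' s := by
    intro x s
    congr 1
    ext y
    simp only [AffineMap.homothety_apply, vsub_eq_sub, vadd_eq_add]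
    module
  have himg : ∀ x : E, MeasurableSet ((fun y => (1 - t) • y + t • x) '' (A ∩ (σ ∘ u) ⁻¹' {x})) := by
    intro x
    refine (hmeas x).image_of_continuousOn_injOn (by fun_prop) ?_
    intro y _ y' _ h
    have : (1 - t) • y = (1 - t) • y' := by simpa using h
    exact smul_right_injective E (by linarith : (1 - t) ≠ 0) this
  have hAeq : A = ⋃ x ∈ X, (A ∩ (σ ∘ u) ⁻¹' {x}) := by
    ext y
    simp only [Set.mem_iUnion, Set.mem_inter_iff, Set.mem_preimage, Set.mem_singleton_iff,
      Function.comp_apply, exists_prop]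
    exact ⟨fun h => ⟨_, hσX (u y), h, rfl⟩, fun ⟨_, _, h, _⟩ => h⟩
  have hdisj : Set.PairwiseDisjoint (X : Set E)
      fun x => (fun y => (1 - t) • y + t • x) '' (A ∩ (σ ∘ u) ⁻¹' {x}) := by
    intro x _ x' _ hne
    rw [Function.onFun, Set.disjoint_left]
    rintro _ ⟨y, ⟨hy, hyx⟩, rfl⟩ ⟨y', ⟨hy', hyx'⟩, he⟩
    have hyx : σ (u y) = x := hyx
    have hyx' : σ (u y') = x' := hyx'
    subst hyx hyx'
    have := hf.gradient_eq_of_slide_eq (fun p q => hσ p _ (hσX q)) (hgrad y' hy').1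
      (hgrad y' hy').2 (hgrad y hy).1 (hgrad y hy).2 ht0 ht1 he
    exact hne (by rw [this])
  calc ENNReal.ofReal ((1 - t) ^ Module.finrank ℝ E) * μ A
      ≤ ENNReal.ofReal ((1 - t) ^ Module.finrank ℝ E) * ∑ x ∈ X, μ (A ∩ (σ ∘ u) ⁻¹' {x}) := by
        gcongr
        conv_lhs => rw [hAeq]
        exact measure_biUnion_finset_le _ _
    _ = ∑ x ∈ X, μ ((fun y => (1 - t) • y + t • x) '' (A ∩ (σ ∘ u) ⁻¹' {x})) := by
        rw [Finset.mul_sum]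
        refine Finset.sum_congr rfl fun x _ => ?_
        rw [hhom, Measure.addHaar_image_homothety, abs_of_nonneg (pow_nonneg (by linarith) _)]
    _ = μ (⋃ x ∈ X, (fun y => (1 - t) • y + t • x) '' (A ∩ (σ ∘ u) ⁻¹' {x})) :=
        (measure_biUnion_finset hdisj fun x _ => himg x).symm
    _ ≤ _ := by
        refine measure_mono (Set.iUnion₂_subset fun x _ => ?_)
        rintro _ ⟨y, ⟨hy, hyx⟩, rfl⟩
        have hyx : σ (u y) = x := hyx
        exact ⟨y, hy, by simp only [hyx]⟩

/-- Sliding a set of points of differentiability along the faces that contain them contracts volume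
at most as much as a homothety does. -/
theorem ConvexOn.le_measure_slideSet (μ : Measure E) [μ.IsAddHaarMeasure] (hf : ConvexOn ℝ S f)
    (hepi : IsClosed {p : E × ℝ | p.1 ∈ S ∧ f p.1 ≤ p.2}) (hA : IsCompact A) (hK : IsCompact K)
    (hum : Measurable u) (hu : ContinuousOn u A)
    (hgrad : ∀ y ∈ A, S ∈ 𝓝 y ∧ HasGradientAt f (u y) y)
    (hcontact : ∀ y ∈ A, ∃ x ∈ K, x ∈ contactSet S f (u y) y)
    {t : ℝ} (ht0 : 0 ≤ t) (ht1 : t < 1) :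
    ENNReal.ofReal ((1 - t) ^ Module.finrank ℝ E) * μ A ≤ μ (slideSet S f u A K t) := by
  have hfA : ContinuousOn f A := fun y hy =>
    (hgrad y hy).2.continuousAt.continuousWithinAt
  rcases A.eq_empty_or_nonempty with rfl | ⟨y₀, hy₀⟩
  · simp
  rw [Set.measure_eq_iInf_isOpen (slideSet S f u A K t)]
  -- By outer regularity, it suffices to slide `A` into each open `U` using finitely many targets
  -- that are only nearly in contact.
  refine le_iInf₂ fun U hsub => le_iInf fun hU => ?_
  obtain ⟨δ, hδ, hδU⟩ := exists_approx_contact_slide_subset hepi hA hK hu hfA hU hsub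
  obtain ⟨X, hXK, hX⟩ := exists_finset_approx_contact hA hu hfA hcontact hδ
  have hXne : X.Nonempty := (hX y₀ hy₀).imp fun x hx => hx.1
  obtain ⟨σ, hσm, hσX, hσ⟩ := exists_measurable_argmin f X hXne
  refine (hf.measure_slide_image μ hA hum hgrad X hσm hσX hσ ht0 ht1).trans (measure_mono ?_)
  rintro _ ⟨y, hy, rfl⟩
  refine hδU y hy _ (hXK _ (hσX _)).1 (hXK _ (hσX _)).2 ?_
  obtain ⟨x, hx, hle⟩ := hX y hy
  have := hσ (u y) x hx
  rw [inner_sub_right] at hle ⊢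
  linarith

end Slide

/-! ### Countable fibres force almost injectivity -/

section Faces

variable {E : Type*} [NormedAddCommGroup E] [InnerProductSpace ℝ E] [FiniteDimensional ℝ E]
  {S : Set E} {f : E → ℝ} {u : E → E} {A K : Set E}

/-- All segments through `z` share one slope, so their starting points lie in a single countable
fibre; the starting point `y` then determines `t` through the height `inner ℝ e z`. -/
theorem ConvexOn.countable_slide_parameters (hf : ConvexOn ℝ S f)
    (hgrad : ∀ y ∈ A, S ∈ 𝓝 y ∧ HasGradientAt f (u y) y)
    (hcount : ∀ p, (A ∩ u ⁻¹' {p}).Countable) {e : E} {c : ℝ}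
    (hlt : ∀ y ∈ A, inner ℝ e y < c) (hKc : ∀ x ∈ K, inner ℝ e x = c) (z : E) :
    {t : ℝ | t ∈ Set.Ico 0 1 ∧ z ∈ slideSet S f u A K t}.Countable := by
  rcases Set.eq_empty_or_nonempty {t : ℝ | t ∈ Set.Ico 0 1 ∧ z ∈ slideSet S f u A K t}
    with h | ⟨s, hs, ⟨y', x'⟩, ⟨hy', -, hx'⟩, hz'⟩
  · rw [h]; exact Set.countable_empty
  refine ((hcount (u y')).image fun y => (inner ℝ e z - inner ℝ e y) / (c - inner ℝ e y)).mono ?_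
  rintro t ⟨ht, ⟨y, x⟩, ⟨hy, hxK, hx⟩, hz⟩
  refine ⟨y, ⟨hy, ?_⟩, ?_⟩
  · exact hf.gradient_eq_of_segments_meet (hgrad y hy).1 (hgrad y hy).2 (hgrad y' hy').1
      (hgrad y' hy').2 hx hx' ht.1 ht.2 hs.1 hs.2.le (hz.trans hz'.symm)
  · have h1 := hlt y hy
    have h2 : inner ℝ e z = (1 - t) * inner ℝ e y + t * c := by
      rw [← hz, ← hKc x hxK, inner_add_right, real_inner_smul_right, real_inner_smul_right]
    have h3 : c - inner ℝ e y ≠ 0 := by linarith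
    simp only [h2]
    field_simp
    ring

variable [MeasurableSpace E] [BorelSpace E]

/-- Fubini on the set of pairs `(z, t)` with `z` in the slid set: its slices at fixed `z` are
countable, so some slice at fixed `t` is null, against the lower volume bound. Stopping at `t = 1 /
2` keeps the contraction factor positive. -/
theorem ConvexOn.measure_eq_zero_of_isCompact (μ : Measure E) [μ.IsAddHaarMeasure]
    (hf : ConvexOn ℝ S f) (hepi : IsClosed {p : E × ℝ | p.1 ∈ S ∧ f p.1 ≤ p.2})
    (hA : IsCompact A) (hK : IsCompact K) (hum : Measurable u) (hu : ContinuousOn u A)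
    (hgrad : ∀ y ∈ A, S ∈ 𝓝 y ∧ HasGradientAt f (u y) y)
    (hcontact : ∀ y ∈ A, ∃ x ∈ K, x ∈ contactSet S f (u y) y)
    (hcount : ∀ p, (A ∩ u ⁻¹' {p}).Countable) {e : E} {c : ℝ}
    (hlt : ∀ y ∈ A, inner ℝ e y < c) (hKc : ∀ x ∈ K, inner ℝ e x = c) : μ A = 0 := by
  have hfA : ContinuousOn f A := fun y hy =>
    (hgrad y hy).2.continuousAt.continuousWithinAt
  let M : Set (E × ℝ) := {q | q.2 ∈ Set.Icc 0 (1 / 2 : ℝ) ∧ q.1 ∈ slideSet S f u A K q.2}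
  have hM : IsCompact M := by
    have hcont : Continuous fun q : ℝ × (E × E) => ((1 - q.1) • q.2.1 + q.1 • q.2.2, q.1) := by
      fun_prop
    convert ((isCompact_Icc (a := (0 : ℝ)) (b := 1 / 2)).prod
      (isCompact_contactPairs hepi hA hK hu hfA)).image hcont using 1
    ext ⟨z, t⟩
    constructor
    · rintro ⟨ht, q, hq, hqz⟩
      exact ⟨(t, q), ⟨ht, hq⟩, Prod.ext hqz rfl⟩
    · rintro ⟨⟨t', q⟩, ⟨ht, hq⟩, he⟩
      obtain ⟨h1, h2⟩ := Prod.ext_iff.1 he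
      have h2 : t' = t := h2
      subst h2
      exact ⟨ht, q, hq, h1⟩
  have hM0 : μ.prod volume M = 0 := by
    rw [Measure.measure_prod_null hM.measurableSet]
    refine Filter.Eventually.of_forall fun z => ?_
    refine ((hf.countable_slide_parameters hgrad hcount hlt hKc z).mono ?_).measure_zero volume
    rintro t ⟨ht, hz⟩
    exact ⟨⟨ht.1, ht.2.trans_lt (by norm_num)⟩, hz⟩
  have hswap : (volume : Measure ℝ).prod μ (Prod.swap ⁻¹' M) = 0 := by
    rw [← Measure.prod_swap, Measure.map_apply measurable_swap
      (measurable_swap hM.measurableSet)]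
    simpa [← Set.preimage_comp] using hM0
  have hae := Measure.measure_ae_null_of_prod_null hswap
  have hpos : volume (Set.Icc 0 (1 / 2 : ℝ)) ≠ 0 := by simp
  obtain ⟨t, ht, hzero⟩ : ∃ t ∈ Set.Icc 0 (1 / 2 : ℝ), μ (slideSet S f u A K t) = 0 := by
    by_contra! hne
    refine hpos (measure_mono_null (fun t ht => ?_) (ae_iff.1 hae))
    intro h0
    refine hne t ht (measure_mono_null (fun z hz => ?_) h0)
    exact ⟨ht, hz⟩
  have ht1 : t < 1 := ht.2.trans_lt (by norm_num)
  have := hf.le_measure_slideSet μ hepi hA hK hum hu hgrad hcontact ht.1 ht1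
  rw [hzero, nonpos_iff_eq_zero, mul_eq_zero] at this
  refine this.resolve_left (ne_of_gt ?_)
  rw [ENNReal.ofReal_pos]
  exact pow_pos (by linarith) _

theorem ConvexOn.measure_contact_eq_zero (μ : Measure E) [μ.IsAddHaarMeasure]
    (hf : ConvexOn ℝ S f) (hepi : IsClosed {p : E × ℝ | p.1 ∈ S ∧ f p.1 ≤ p.2})
    (hK : IsCompact K) (hum : Measurable u) {G : Set E} (hG : NullMeasurableSet G μ)
    (hfin : μ G ≠ ⊤) (hgrad : ∀ y ∈ G, S ∈ 𝓝 y ∧ HasGradientAt f (u y) y)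
    (hcount : ∀ p, (G ∩ u ⁻¹' {p}).Countable) {e : E} {c : ℝ}
    (hKc : ∀ x ∈ K, inner ℝ e x = c) :
    μ {y | y ∈ G ∧ inner ℝ e y < c ∧ ∃ x ∈ K, x ∈ contactSet S f (u y) y} = 0 := by
  set P := {y | y ∈ G ∧ inner ℝ e y < c ∧ ∃ x ∈ K, x ∈ contactSet S f (u y) y}
  by_contra hP
  have hopen : IsOpen {y : E | inner ℝ e y < c} :=
    isOpen_lt (continuous_const.inner continuous_id) continuous_const
  obtain ⟨G₁, hG₁s, hG₁m, hG₁⟩ :=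
    (hG.inter hopen.measurableSet.nullMeasurableSet).exists_measurable_subset_ae_eq
  have hG₁fin : μ G₁ ≠ ⊤ :=
    measure_ne_top_of_subset (hG₁s.trans Set.inter_subset_left) hfin
  -- The error allowed in Lusin's theorem is `μ P` itself: the part of `P` over `C` is null, so the
  -- rest would have to carry all of `μ P`. No measurability of `P` is needed.
  obtain ⟨C, hCs, hC, huC, hCm⟩ := exists_isCompact_continuousOn hum hG₁m hG₁fin hP
  have hCG : ∀ y ∈ C, y ∈ G ∧ inner ℝ e y < c := fun y hy => hG₁s (hCs hy)
  have hfC : ContinuousOn f C := fun y hy =>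
    (hgrad y (hCG y hy).1).2.continuousAt.continuousWithinAt
  have hAC : Prod.fst '' contactPairs S f u C K ⊆ C := by
    rintro _ ⟨q, hq, rfl⟩
    exact hq.1
  have hA0 : μ (Prod.fst '' contactPairs S f u C K) = 0 := by
    refine hf.measure_eq_zero_of_isCompact μ hepi
      ((isCompact_contactPairs hepi hC hK huC hfC).image continuous_fst) hK hum (huC.mono hAC)
      (fun y hy => hgrad y (hCG y (hAC hy)).1) ?_ (fun p => (hcount p).mono ?_)
      (fun y hy => (hCG y (hAC hy)).2) hKc
    · rintro _ ⟨q, hq, rfl⟩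
      exact ⟨q.2, hq.2⟩
    · exact Set.inter_subset_inter_left _ fun y hy => (hCG y (hAC hy)).1
  have hsub : P ⊆ (Prod.fst '' contactPairs S f u C K) ∪ (G₁ \ C) ∪
      ((G ∩ {y : E | inner ℝ e y < c}) \ G₁) := by
    rintro y ⟨hyG, hyc, x, hxK, hx⟩
    by_cases hy1 : y ∈ G₁
    · by_cases hyC : y ∈ C
      · exact Or.inl (Or.inl ⟨(y, x), ⟨hyC, hxK, hx⟩, rfl⟩)
      · exact Or.inl (Or.inr ⟨hy1, hyC⟩)
    · exact Or.inr ⟨⟨hyG, hyc⟩, hy1⟩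
  have hdiff : μ ((G ∩ {y : E | inner ℝ e y < c}) \ G₁) = 0 := ae_le_set.1 hG₁.symm.le
  have hle := calc μ P ≤ _ := measure_mono hsub
    _ ≤ μ ((Prod.fst '' contactPairs S f u C K) ∪ (G₁ \ C)) +
        μ ((G ∩ {y : E | inner ℝ e y < c}) \ G₁) := measure_union_le _ _
    _ ≤ μ (Prod.fst '' contactPairs S f u C K) + μ (G₁ \ C) + 0 := by
        rw [hdiff]; gcongr; exact measure_union_le _ _
  rw [hA0, zero_add, add_zero] at hle
  exact hle.not_gt hCm

/-- If the gradient of a convex function has countable fibres on a set, it is almost injective on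
that set. -/
theorem ConvexOn.measure_nonunique_gradient_eq_zero (μ : Measure E) [μ.IsAddHaarMeasure]
    (hf : ConvexOn ℝ S f) (hepi : IsClosed {p : E × ℝ | p.1 ∈ S ∧ f p.1 ≤ p.2})
    (hum : Measurable u) {G : Set E} (hG : NullMeasurableSet G μ)
    (hfin : μ G ≠ ⊤) (hgrad : ∀ y ∈ G, S ∈ 𝓝 y ∧ HasGradientAt f (u y) y)
    (hcount : ∀ p, (G ∩ u ⁻¹' {p}).Countable) :
    μ {y | y ∈ G ∧ ∃ y' ∈ G, y' ≠ y ∧ u y' = u y} = 0 := by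
  let K : ℕ → ℚ → ℕ → Set E := fun k c R =>
    {x | inner ℝ (TopologicalSpace.denseSeq E k) x = (c : ℝ)} ∩ Metric.closedBall 0 R
  have hK : ∀ k c R, IsCompact (K k c R) := fun k c R =>
    (isCompact_closedBall _ _).inter_left
      (isClosed_eq (continuous_const.inner continuous_id) continuous_const)
  have hnull : μ (⋃ (k : ℕ) (c : ℚ) (R : ℕ), {y | y ∈ G ∧
      inner ℝ (TopologicalSpace.denseSeq E k) y < (c : ℝ) ∧
      ∃ x ∈ K k c R, x ∈ contactSet S f (u y) y}) = 0 := by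
    simp only [measure_iUnion_null_iff]
    exact fun k c R => hf.measure_contact_eq_zero μ hepi (hK k c R) hum hG hfin hgrad hcount
      fun x hx => hx.1
  refine measure_mono_null ?_ hnull
  rintro y ⟨hy, y', hy', hne, huy⟩
  have hopen : IsOpen {e : E | 0 < (inner ℝ e (y' - y) : ℝ)} :=
    isOpen_lt continuous_const (continuous_id.inner continuous_const)
  obtain ⟨k, hk⟩ := (TopologicalSpace.denseRange_denseSeq E).exists_mem_open hopen
    ⟨y' - y, real_inner_self_pos.2 (sub_ne_zero.2 hne)⟩
  set e := TopologicalSpace.denseSeq E k with he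
  have hk : 0 < (inner ℝ e (y' - y) : ℝ) := hk
  rw [inner_sub_right] at hk
  obtain ⟨c, hc1, hc2⟩ := exists_rat_btwn (sub_pos.1 hk)
  obtain ⟨R, hR⟩ := exists_nat_ge (max ‖y‖ ‖y'‖)
  refine Set.mem_iUnion.2 ⟨k, Set.mem_iUnion.2 ⟨c, Set.mem_iUnion.2 ⟨R, hy, hc1, ?_⟩⟩⟩
  have hyS := mem_of_mem_nhds (hgrad y hy).1
  have hyS' := mem_of_mem_nhds (hgrad y' hy').1
  -- The parameter at which the segment from `y` to `y'` crosses the hyperplane.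
  set s : ℝ := (c - inner ℝ e y) / (inner ℝ e y' - inner ℝ e y) with hs
  have hs0 : 0 ≤ s := div_nonneg (by linarith) hk.le
  have hs1 : s ≤ 1 := (div_le_one hk).2 (by linarith)
  have hsc : s * (inner ℝ e y' - inner ℝ e y) = c - inner ℝ e y := div_mul_cancel₀ _ hk.ne'
  refine ⟨(1 - s) • y + s • y', ⟨?_, ?_⟩, hf.1 hyS hyS' (by linarith) hs0 (by ring), ?_⟩
  · change inner ℝ e ((1 - s) • y + s • y') = (c : ℝ)
    rw [inner_add_right, real_inner_smul_right, real_inner_smul_right]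
    linarith
  · exact (convex_closedBall (0 : E) (R : ℝ)) (by simpa using (le_max_left _ _).trans hR)
      (by simpa using (le_max_right _ _).trans hR) (by linarith) hs0 (by ring)
  · have h1 := hf.2 hyS hyS' (by linarith : 0 ≤ 1 - s) hs0 (by ring)
    have h2 := hf.add_inner_le_of_hasGradientAt hyS' (hgrad y' hy').2 hyS
    have h3 : (inner ℝ (u y) ((1 - s) • y + s • y' - y) : ℝ) = s * inner ℝ (u y) (y' - y) := by
      rw [← real_inner_smul_right]; congr 1; module
    rw [huy, ← neg_sub y' y, inner_neg_right] at h2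
    rw [h3]
    simp only [smul_eq_mul] at h1
    nlinarith [mul_le_mul_of_nonneg_left h2 hs0]

end Faces

/-! ### From extended-real-valued functions to the theorem -/

theorem EConvex.convexOn_toReal {E : Type*} [AddCommGroup E] [Module ℝ E] {ψ : E → EReal}
    (hψ : EConvex ψ) (hbot : ∀ x, ψ x ≠ ⊥) :
    ConvexOn ℝ {x | ψ x ≠ ⊤} fun x => (ψ x).toReal := by
  have key : ∀ x, ψ x ≠ ⊤ → ∀ y, ψ y ≠ ⊤ → ∀ a b : ℝ, 0 ≤ a → 0 ≤ b → a + b = 1 →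
      ψ (a • x + b • y) ≤ ((a * (ψ x).toReal + b * (ψ y).toReal : ℝ) : EReal) := by
    intro x hx y hy a b ha hb hab
    have hmem : ∀ w, ψ w ≠ ⊤ → (w, (ψ w).toReal) ∈ {p : E × ℝ | ψ p.1 ≤ (p.2 : EReal)} :=
      fun w hw => (EReal.coe_toReal hw (hbot w)).ge
    exact hψ (hmem x hx) (hmem y hy) ha hb hab
  refine ⟨fun x hx y hy a b ha hb hab => ?_, fun x hx y hy a b ha hb hab => ?_⟩
  · exact ((key x hx y hy a b ha hb hab).trans_lt (EReal.coe_lt_top _)).ne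
  · exact EReal.toReal_le_toReal (key x hx y hy a b ha hb hab) (hbot _) (EReal.coe_ne_top _)

theorem LowerSemicontinuous.isClosed_epigraph_toReal {E : Type*} [TopologicalSpace E]
    {ψ : E → EReal} (hψ : LowerSemicontinuous ψ) (hbot : ∀ x, ψ x ≠ ⊥) :
    IsClosed {p : E × ℝ | p.1 ∈ {x | ψ x ≠ ⊤} ∧ (ψ p.1).toReal ≤ p.2} := by
  have hcont : Continuous fun p : E × ℝ => (p.1, (p.2 : EReal)) :=
    continuous_fst.prodMk (continuous_coe_real_ereal.comp continuous_snd)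
  convert hψ.isClosed_epigraph.preimage hcont using 1
  ext ⟨x, r⟩
  constructor
  · rintro ⟨h1, h2⟩
    change ψ x ≤ (r : EReal)
    rw [← EReal.coe_toReal h1 (hbot x)]
    exact EReal.coe_le_coe_iff.2 h2
  · intro h
    have h : ψ x ≤ (r : EReal) := h
    exact ⟨(h.trans_lt (EReal.coe_lt_top _)).ne,
      EReal.toReal_le_toReal h (hbot x) (EReal.coe_ne_top _)⟩

/-- Level sets are disjoint inside a set of finite measure, so only countably many of them are
removed. -/
theorem nullMeasurableSet_complPosLevelSets {E F : Type*} [MeasureSpace E] [MeasurableSpace F]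
    [MeasurableSingletonClass F] {f : E → F} {S : Set E} (hS : NullMeasurableSet S volume)
    (hfin : volume S ≠ ⊤) (hf : AEMeasurable f (volume.restrict S)) :
    NullMeasurableSet (complPosLevelSets f S) volume := by
  have hlevel : ∀ a, NullMeasurableSet (levelSetOn f S a) volume := by
    intro a
    have h1 : (S ∩ hf.mk f ⁻¹' {a} : Set E) =ᵐ[volume] levelSetOn f S a := by
      have := (ae_restrict_iff'₀ hS).1 hf.ae_eq_mk
      filter_upwards [this] with y hy
      refine propext ⟨fun h => ⟨h.1, (hy h.1).trans h.2⟩, fun h => ⟨h.1, (hy h.1).symm.trans h.2⟩⟩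
    exact (hS.inter (hf.measurable_mk (measurableSet_singleton a)).nullMeasurableSet).congr h1
  have hdisj : Pairwise (Function.onFun (AEDisjoint volume) (levelSetOn f S)) := by
    intro a b hab
    refine Disjoint.aedisjoint (Set.disjoint_left.2 ?_)
    rintro y ⟨-, rfl⟩ ⟨-, rfl⟩
    exact hab rfl
  have hsub : (⋃ a, levelSetOn f S a) ⊆ S := Set.iUnion_subset fun a y hy => hy.1
  have hcount := Measure.countable_meas_pos_of_disjoint_of_meas_iUnion_ne_top₀ volume hlevel hdisj
    (measure_ne_top_of_subset hsub hfin)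
  exact hS.diff (.biUnion hcount fun a _ => hlevel a)

theorem lemma1 (n : ℕ) (Y : Set (EuclideanSpace ℝ (Fin n)))
    (hY : NullMeasurableSet Y volume) (hY_pos : 0 < volume Y) (hY_fin : volume Y < ⊤)
    (ψ : EuclideanSpace ℝ (Fin n) → EReal)
    (hψ_proper : EProper ψ) (hψ_lsc : LowerSemicontinuous ψ) (hψ_conv : EConvex ψ)
    (u : EuclideanSpace ℝ (Fin n) → EuclideanSpace ℝ (Fin n))
    (hu_int : IntegrableOn u Y volume)
    (hu_grad : ∀ᵐ y ∂volume, y ∈ Y → EHasGradientAt ψ (u y) y)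
    (hu_inj : ¬ AlmostInjectiveOn u (complPosLevelSets u Y))
    (Y' : Set (EuclideanSpace ℝ (Fin n))) (hY'_sub : Y' ⊆ complPosLevelSets u Y)
    (hY'_full : volume (complPosLevelSets u Y \ Y') = 0) :
    ∃ a : EuclideanSpace ℝ (Fin n),
      volume (levelSetOn u Y a) = 0 ∧ ¬ (levelSetOn u Y a ∩ Y').Countable := by
  by_contra! hcon
  have hum : AEMeasurable u (volume.restrict Y) := hu_int.aestronglyMeasurable.aemeasurable
  have hu_eq := (ae_restrict_iff'₀ hY).1 hum.ae_eq_mk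
  set v := hum.mk u
  have hY₀Y : complPosLevelSets u Y ⊆ Y := Set.sdiff_subset
  -- The sliding argument needs a measurable gradient map, so `u` is replaced by its representative
  -- `v` where they agree.
  let G := {y | y ∈ Y' ∧ EHasGradientAt ψ (u y) y ∧ u y = v y}
  have hGY' : G ⊆ Y' := fun y hy => hy.1
  have hdiff : volume (complPosLevelSets u Y \ G) = 0 := by
    refine measure_mono_null (t := (complPosLevelSets u Y \ Y') ∪
      ({y | ¬ (y ∈ Y → EHasGradientAt ψ (u y) y)} ∪ {y | ¬ (y ∈ Y → u y = v y)})) ?_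
      (measure_union_null hY'_full (measure_union_null (ae_iff.1 hu_grad) (ae_iff.1 hu_eq)))
    rintro y ⟨hy, hyG⟩
    by_contra hn
    simp only [Set.mem_union, Set.mem_ofPred_eq, not_or, not_not] at hn
    have h1 : y ∈ Y' := by_contra fun h => hn.1 ⟨hy, h⟩
    exact hyG ⟨h1, hn.2.1 (hY₀Y hy), hn.2.2 (hY₀Y hy)⟩
  have hGae : complPosLevelSets u Y =ᵐ[volume] G :=
    (ae_le_set.2 hdiff).antisymm (LE.le.eventuallyLE (hGY'.trans hY'_sub))
  have hG : NullMeasurableSet G volume :=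
    (nullMeasurableSet_complPosLevelSets hY hY_fin.ne hum).congr hGae
  have hGfin : volume G ≠ ⊤ :=
    measure_ne_top_of_subset ((hGY'.trans hY'_sub).trans hY₀Y) hY_fin.ne
  have hcount : ∀ p, (G ∩ v ⁻¹' {p}).Countable := by
    intro p
    rcases (G ∩ v ⁻¹' {p}).eq_empty_or_nonempty with h | ⟨y, hyG, hyp⟩
    · rw [h]; exact Set.countable_empty
    · have hsub : G ∩ v ⁻¹' {p} ⊆ levelSetOn u Y p ∩ Y' := fun w hw =>
        ⟨⟨hY₀Y (hY'_sub hw.1.1), hw.1.2.2.trans hw.2⟩, hw.1.1⟩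
      refine (hcon p ?_).mono hsub
      by_contra hne
      -- A level set of positive measure has been removed from `Y₀`, so it cannot contain `y`.
      exact (hY'_sub hyG.1).2 (Set.mem_biUnion (Set.mem_ofPred_eq ▸ pos_iff_ne_zero.2 hne)
        (hsub ⟨hyG, hyp⟩).1)
  have hnull := (hψ_conv.convexOn_toReal hψ_proper.2).measure_nonunique_gradient_eq_zero volume
    (hψ_lsc.isClosed_epigraph_toReal hψ_proper.2) hum.measurable_mk hG hGfin
    (fun y hy => ⟨hy.2.1.1.mono fun z hz => hz.1, by
      have h := hy.2.1.2; rw [hy.2.2] at h; exact h⟩) hcount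
  refine hu_inj ⟨G \ {y | y ∈ G ∧ ∃ y' ∈ G, y' ≠ y ∧ v y' = v y},
    Set.sdiff_subset.trans (hGY'.trans hY'_sub), ?_, ?_⟩
  · rintro y ⟨hy, hyn⟩ y' ⟨hy', -⟩ huy
    by_contra hne
    exact hyn ⟨hy, y', hy', Ne.symm hne, by rw [← hy.2.2, ← hy'.2.2, huy]⟩
  · refine measure_mono_null (fun y hy => ?_) (measure_union_null hdiff hnull)
    by_cases hyG : y ∈ G
    · exact Or.inr (by_contra fun h => hy.2 ⟨hyG, h⟩)
    · exact Or.inl ⟨hy.1, hyG⟩
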